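/- Let $V:\mathbb R\to\mathbb R$ be continuous with $V(x+1)=V(x)$ and let $s\in\{1,-1\}$. Consider $$ i\psi_t=-\tfrac12\psi_{xx}+s\,\epsilon|\psi|^2\psi+V(x)\psi , $$ which is focusing if $s\epsilon<0$ and defocusing if $s\epsilon>0$ (so for $s=-1$ it is focusing exactly when $\epsilon>0$). Let $\psi=e^{-i\omega(\epsilon)t}\phi(x,\epsilon)$, $|\epsilon|<\delta$, be a family of standing waves, where $\phi$ is real valued and $C^2$ in $(x,\epsilon)$ and either $\phi(x+1,\epsilon)=\phi(x,\epsilon)$ for all $x,\epsilon$ or $\phi(x+1,\epsilon)=-\phi(x,\epsilon)$ for all $x,\epsilon$, and $\phi(\cdot,0)\not\equiv0$, so that $\phi(\cdot,0)$ is an eigenfunction of $H=-\frac12\partial_{xx}+V$ with eigenvalue $\omega(0)$, a band edge of $H$. Assume that $\omega(0)$ is not a double point, i.e. the solutions of $Hv=\omega(0)v$ are neither all $1$-periodic nor all $1$-antiperiodic. Put $L_-=-\frac12\partial_{xx}+V+s\epsilon\phi^2-\omega(\epsilon)$ and $L_+=-\frac12\partial_{xx}+V+3s\epsilon\phi^2-\omega(\epsilon)$.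 The spectrum of the stability problem $$ L_+p=\mu q,\qquad L_-q=\mu p $$ is the set of $\mu\in\mathbb C$ for which its monodromy matrix over one period has an eigenvalue of modulus $1$; in this normalization perturbations evolve like $e^{-i\mu t}$, so that spectrum off the real axis means instability. (i) If $\omega(0)$ is the lower edge of a band of $H$, there is $\epsilon_0\in(0,\delta]$ such that for every $\epsilon$ with $|\epsilon|<\epsilon_0$ and $s\epsilon<0$ (weak focusing nonlinearity) there is $\eta>0$ with $\{it:\ t\in\mathbb R,\ |t|<\eta\}$ contained in the spectrum of the stability problem. (ii) If $\omega(0)$ is the upper edge of a band of $H$, there is $\epsilon_0\in(0,\delta]$ such that for every $\epsilon$ with $|\epsilon|<\epsilon_0$ and $s\epsilon>0$ (weak defocusing nonlinearity) there is $\eta>0$ with $\{it:\ t\in\mathbb R,\ |t|<\eta\}$ contained in the spectrum of the stability problem. -/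

import Mathlib

namespace PeriodicNLS

/-- `M` is the monodromy matrix (period map over `[0, 1]`) of the linear system
`y' = A(x) y`: `M = U(1)`, where `U' = A U` and `U(0) = I`. -/
def IsMonodromy {n : ℕ} (A : ℝ → Matrix (Fin n) (Fin n) ℂ)
    (M : Matrix (Fin n) (Fin n) ℂ) : Prop :=
  ∃ U : ℝ → Matrix (Fin n) (Fin n) ℂ,
    U 0 = 1 ∧
    (∀ x i j, HasDerivAt (fun y => U y i j) ((A x * U x) i j) x) ∧
    U 1 = M

/-- `ρ` is a Floquet multiplier of `y' = A(x) y`: an eigenvalue of its monodromy matrix. -/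
def IsMultiplier {n : ℕ} (A : ℝ → Matrix (Fin n) (Fin n) ℂ) (ρ : ℂ) : Prop :=
  ∃ M, IsMonodromy A M ∧ Module.End.HasEigenvalue (Matrix.toLin' M) ρ

/-- The Schrödinger equation `-(1/2) v'' + V v = lam v` as a first order system
in `(v, v')`. -/
noncomputable def hillSystem (V : ℝ → ℝ) (lam : ℝ) : ℝ → Matrix (Fin 2) (Fin 2) ℂ :=
  fun x => !![0, 1; 2 * ((V x : ℂ) - (lam : ℂ)), 0]

/-- The spectrum of `-(1/2) ∂ₓₓ + V` (the union of its bands): the real `lam` at which the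
monodromy matrix has an eigenvalue on the unit circle. -/
def hillSpectrum (V : ℝ → ℝ) : Set ℝ :=
  {lam | ∃ ρ : ℂ, ‖ρ‖ = 1 ∧ IsMultiplier (hillSystem V lam) ρ}

/-- Band edges: the periodic and the antiperiodic eigenvalues. -/
def IsBandEdge (V : ℝ → ℝ) (lam : ℝ) : Prop :=
  IsMultiplier (hillSystem V lam) 1 ∨ IsMultiplier (hillSystem V lam) (-1)

/-- Double points: all solutions are periodic, or all solutions are antiperiodic
(the two band edges at the ends of a gap coincide). -/
def IsDoublePoint (V : ℝ → ℝ) (lam : ℝ) : Prop :=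
  IsMonodromy (hillSystem V lam) 1 ∨ IsMonodromy (hillSystem V lam) (-1)

/-- The band edge `lam` is the lower end of a band. -/
def IsLowerBandEdge (V : ℝ → ℝ) (lam : ℝ) : Prop :=
  IsBandEdge V lam ∧ ∃ η > 0, Set.Icc lam (lam + η) ⊆ hillSpectrum V

/-- The band edge `lam` is the upper end of a band. -/
def IsUpperBandEdge (V : ℝ → ℝ) (lam : ℝ) : Prop :=
  IsBandEdge V lam ∧ ∃ η > 0, Set.Icc (lam - η) lam ⊆ hillSpectrum V

/-- The real profile `f` gives a standing wave `ψ(x, t) = exp(-i ω t) f(x)` of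
`i ψ_t = -(1/2) ψ_xx + g |ψ|² ψ + V ψ` (focusing for `g < 0`, defocusing for `g > 0`). -/
def IsStandingWave (V : ℝ → ℝ) (g ω : ℝ) (f : ℝ → ℝ) : Prop :=
  ContDiff ℝ 2 f ∧
  ∀ x, ω * f x = -(1 / 2) * deriv (deriv f) x + g * f x ^ 3 + V x * f x

/-- The linearized stability problem `L₊ p = μ q`, `L₋ q = μ p` (perturbations
`ψ = exp(-i ω t) (f + u)` whose time dependence is `exp(-i μ t)`) as a first order system in
`(p, p', q, q')`, where `L₊ = -(1/2) ∂ₓₓ + V + 3 g f² - ω` and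
`L₋ = -(1/2) ∂ₓₓ + V + g f² - ω`. -/
noncomputable def stabilitySystem (V : ℝ → ℝ) (g ω : ℝ) (f : ℝ → ℝ) (μ : ℂ) :
    ℝ → Matrix (Fin 4) (Fin 4) ℂ :=
  fun x =>
    !![0, 1, 0, 0;
       2 * ((V x + 3 * g * f x ^ 2 - ω : ℝ) : ℂ), 0, -2 * μ, 0;
       0, 0, 0, 1;
       -2 * μ, 0, 2 * ((V x + g * f x ^ 2 - ω : ℝ) : ℂ), 0]

/-- The (Floquet) spectrum of the stability problem: those `μ` for which the monodromy matrix
has an eigenvalue on the unit circle. -/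
def stabilitySpectrum (V : ℝ → ℝ) (g ω : ℝ) (f : ℝ → ℝ) : Set ℂ :=
  {μ | ∃ ρ : ℂ, ‖ρ‖ = 1 ∧ IsMultiplier (stabilitySystem V g ω f μ) ρ}

/-- A `C²` family of real standing waves `φ(·, ε)`, `|ε| < δ`, with frequencies `ω(ε)`, of the
equation with nonlinearity `s ε |ψ|² ψ`, all periodic or all antiperiodic, which bifurcates
from an eigenfunction `φ(·, 0)` of `-(1/2) ∂ₓₓ + V` with eigenvalue `ω(0)`. -/
structure IsStandingWaveFamily (V : ℝ → ℝ) (s δ : ℝ) (φ : ℝ → ℝ → ℝ) (ω : ℝ → ℝ) : Prop where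
  contDiffOn : ContDiffOn ℝ 2 (fun z : ℝ × ℝ => φ z.1 z.2) (Set.univ ×ˢ Set.Ioo (-δ) δ)
  standing_wave : ∀ ε ∈ Set.Ioo (-δ) δ,
    IsStandingWave V (s * ε) (ω ε) (fun x => φ x ε)
  periodic_or_antiperiodic :
    (∀ ε ∈ Set.Ioo (-δ) δ, Function.Periodic (fun x => φ x ε) 1) ∨
    (∀ ε ∈ Set.Ioo (-δ) δ, Function.Antiperiodic (fun x => φ x ε) 1)
  nontrivial : ∃ x, φ x 0 ≠ 0

end PeriodicNLS

/-! At `μ = 0` the stability system splits into the Hill equations of `L₊` and `L₋`, whose period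
matrices have determinant one. The wave itself solves `L₋ φ = 0` and is multiplied by `σ = ±1` over
a period, so the trace for `L₋` is exactly `2σ`. Since `L₊ = L₋ + 2sεφ²`, the exact formula
`IsHillBasis.trace_sub_trace` gives the trace for `L₊` as `2σ + sε I(ε)`. At a band edge that is not
a double point the density in this formula is `c φ(·,0)²` with `c ≠ 0`
(`IsHillBasis.exists_density`), so `I(ε)` tends to `4c ∫ φ(·,0)⁴`. The same formula, applied to a
shift of the energy into the band, where the trace is at most `2` in modulus, fixes the sign: `κσc >
0`, with `κ = 1` at a lower and `κ = -1` at an upper edge (`density_sign_of_band`). Hence for small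
`ε` with `κsε < 0` the trace for `L₊` lies strictly between `-2` and `2`, and `L₊` has multipliers
`exp(±iθ)` with `0 < θ < π`.

For `μ = it` an indefinite Hermitian form is conserved, which makes the normalized characteristic
polynomial real on the unit circle. At `t = 0` its value at `exp(iψ)` is `(2 cos ψ - 2 cos θ)(2 cos
ψ - 2σ)`, which changes sign at `ψ = θ`. The sign change survives for small `t`, so some multiplier
remains on the circle (`exists_imaginary_interval`). -/

open Set Filter Topology

namespace PeriodicNLS

/-! ### Uniform convergence on the period interval -/

/-- Continuous convergence on `[0, 1]`; for continuous limits this is uniform convergence. -/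
def TendstoContinuously {ι E : Type*} [TopologicalSpace E] (l : Filter ι) (F : ι → ℝ → E)
    (f : ℝ → E) : Prop :=
  ∀ x ∈ Icc (0 : ℝ) 1,
    Tendsto (fun y : ι × ℝ => F y.1 y.2) (l ×ˢ 𝓝[Icc (0 : ℝ) 1] x) (𝓝 (f x))

theorem tendstoContinuously_of_tendstoUniformlyOn {ι E : Type*} [PseudoMetricSpace E]
    {l : Filter ι} {F : ι → ℝ → E} {f : ℝ → E} (hf : Continuous f)
    (h : TendstoUniformlyOn F f l (Icc 0 1)) : TendstoContinuously l F f := by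
  intro x hx
  have h1 := tendstoLocallyUniformlyOn_iff_forall_tendsto.1 h.tendstoLocallyUniformlyOn x hx
  have h2 : Tendsto (fun y : ι × ℝ => f y.2) (l ×ˢ 𝓝[Icc (0 : ℝ) 1] x) (𝓝 (f x)) :=
    ((hf.tendsto x).mono_left nhdsWithin_le_nhds).comp tendsto_snd
  exact (h2.congr_uniformity h1)

theorem TendstoContinuously.tendstoUniformlyOn {ι E : Type*} [PseudoMetricSpace E]
    {l : Filter ι} {F : ι → ℝ → E} {f : ℝ → E} (hf : Continuous f)
    (h : TendstoContinuously l F f) : TendstoUniformlyOn F f l (Icc 0 1) := by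
  rw [← tendstoLocallyUniformlyOn_iff_tendstoUniformlyOn_of_compact isCompact_Icc,
    tendstoLocallyUniformlyOn_iff_forall_tendsto]
  intro x hx
  have h2 : Tendsto (fun y : ι × ℝ => f y.2) (l ×ˢ 𝓝[Icc (0 : ℝ) 1] x) (𝓝 (f x)) :=
    ((hf.tendsto x).mono_left nhdsWithin_le_nhds).comp tendsto_snd
  have := (h2.prodMk_nhds (h x hx)).mono_right (nhds_le_uniformity (f x))
  exact this

theorem TendstoContinuously.tendsto_apply {ι E : Type*} [TopologicalSpace E]
    {l : Filter ι} {F : ι → ℝ → E} {f : ℝ → E} (h : TendstoContinuously l F f)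
    {x : ℝ} (hx : x ∈ Icc (0 : ℝ) 1) : Tendsto (fun i => F i x) l (𝓝 (f x)) := by
  have h1 : Tendsto (fun _ : ι => x) l (𝓝[Icc (0 : ℝ) 1] x) :=
    tendsto_nhdsWithin_iff.2 ⟨tendsto_const_nhds, Eventually.of_forall fun _ => hx⟩
  exact (h x hx).comp (tendsto_id.prodMk h1)

theorem TendstoContinuously.comp {ι E E' : Type*} [TopologicalSpace E] [TopologicalSpace E']
    {l : Filter ι} {F : ι → ℝ → E} {f : ℝ → E} (h : TendstoContinuously l F f)
    {g : E → E'} (hg : Continuous g) :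
    TendstoContinuously l (fun i x => g (F i x)) (fun x => g (f x)) :=
  fun x hx => (hg.tendsto _).comp (h x hx)

theorem TendstoContinuously.prodMk {ι E E' : Type*} [TopologicalSpace E] [TopologicalSpace E']
    {l : Filter ι} {F : ι → ℝ → E} {f : ℝ → E} {G : ι → ℝ → E'} {g : ℝ → E'}
    (hf : TendstoContinuously l F f) (hg : TendstoContinuously l G g) :
    TendstoContinuously l (fun i x => (F i x, G i x)) (fun x => (f x, g x)) :=
  fun x hx => (hf x hx).prodMk_nhds (hg x hx)

theorem tendstoContinuously_const {ι E : Type*} [TopologicalSpace E] {l : Filter ι}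
    {f : ℝ → E} (hf : Continuous f) : TendstoContinuously l (fun _ => f) f :=
  fun x _ => ((hf.tendsto x).mono_left nhdsWithin_le_nhds).comp tendsto_snd

theorem tendstoContinuously_of_tendsto {ι E : Type*} [TopologicalSpace E] {l : Filter ι}
    {u : ι → E} {a : E} (hu : Tendsto u l (𝓝 a)) :
    TendstoContinuously l (fun i _ => u i) (fun _ => a) :=
  fun _ _ => hu.comp tendsto_fst

theorem TendstoContinuously.tendsto_integral {ι : Type*} {l : Filter ι} [l.IsCountablyGenerated]
    {F : ι → ℝ → ℝ} {f : ℝ → ℝ} (hF : ∀ i, Continuous (F i)) (hf : Continuous f)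
    (h : TendstoContinuously l F f) :
    Tendsto (fun i => ∫ x in (0 : ℝ)..1, F i x) l (𝓝 (∫ x in (0 : ℝ)..1, f x)) := by
  apply TendstoUniformlyOn.tendsto_intervalIntegral_of_continuousOn
  · exact Eventually.of_forall fun i => (hF i).continuousOn
  · rw [uIcc_of_le zero_le_one]
    exact h.tendstoUniformlyOn hf

/-! ### Linear differential equations in a Banach algebra: existence and continuous dependence -/

section BanachAlgebra

variable {𝔸 : Type*} [NormedRing 𝔸] [NormedAlgebra ℝ 𝔸]

/-- Picard iterates of `y' = A y`, `y 0 = 1`. -/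
noncomputable def picardIterate (A : ℝ → 𝔸) : ℕ → ℝ → 𝔸
  | 0, _ => 1
  | n + 1, x => ∫ t in (0 : ℝ)..x, A t * picardIterate A n t

theorem continuous_picardIterate {A : ℝ → 𝔸} (hA : Continuous A) (n : ℕ) :
    Continuous (picardIterate A n) := by
  induction n with
  | zero => exact continuous_const
  | succ n ih =>
    exact intervalIntegral.continuous_primitive
      (fun a b => (hA.mul ih).intervalIntegrable a b) 0

theorem norm_picardIterate_le {A : ℝ → 𝔸} {T K : ℝ}
    (hK : ∀ x, |x| ≤ T → ‖A x‖ ≤ K) (n : ℕ) {x : ℝ} (hx : |x| ≤ T) :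
    ‖picardIterate A n x‖ ≤ ‖(1 : 𝔸)‖ * (K * |x|) ^ n / n.factorial := by
  have hK0 : 0 ≤ K := (norm_nonneg _).trans (hK x hx)
  induction n generalizing x with
  | zero => simp [picardIterate]
  | succ n ih =>
    have h1 : ‖picardIterate A (n + 1) x‖ ≤
        ∫ t in uIoc 0 x, K * (‖(1 : 𝔸)‖ * K ^ n / n.factorial) * |t - 0| ^ n := by
      simp only [picardIterate]
      rw [intervalIntegral.norm_intervalIntegral_eq]
      apply MeasureTheory.norm_integral_le_of_norm_le
      · apply Continuous.integrableOn_uIoc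
        fun_prop
      · refine (MeasureTheory.ae_restrict_iff' measurableSet_uIoc).2 (Eventually.of_forall ?_)
        intro t ht
        have htx : |t| ≤ |x| := by
          have := abs_sub_left_of_mem_uIcc (uIoc_subset_uIcc ht)
          simpa using this
        have htT := htx.trans hx
        calc ‖A t * picardIterate A n t‖ ≤ ‖A t‖ * ‖picardIterate A n t‖ := norm_mul_le _ _
          _ ≤ K * (‖(1 : 𝔸)‖ * (K * |t|) ^ n / n.factorial) := by
            gcongr
            · exact hK t htT
            · exact ih htT
          _ = _ := by rw [sub_zero, mul_pow]; ring
    refine h1.trans (le_of_eq ?_)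
    rw [MeasureTheory.integral_const_mul, integral_pow_abs_sub_uIoc, sub_zero, mul_pow,
      Nat.factorial_succ]
    push_cast
    field_simp
    ring

theorem tendstoContinuously_linearODE_solution {ι : Type*} {l : Filter ι}
    {A : ι → ℝ → 𝔸} {A₀ : ℝ → 𝔸} {U : ι → ℝ → 𝔸} {U₀ : ℝ → 𝔸} (hA₀ : Continuous A₀)
    (hA : TendstoContinuously l A A₀) (hU0 : ∀ i, U i 0 = 1)
    (hU : ∀ i x, HasDerivAt (U i) (A i x * U i x) x)
    (hU₀0 : U₀ 0 = 1) (hU₀ : ∀ x, HasDerivAt U₀ (A₀ x * U₀ x) x) :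
    TendstoContinuously l U U₀ := by
  have hcU₀ : Continuous U₀ := continuous_iff_continuousAt.2 fun x => (hU₀ x).continuousAt
  have hcU : ∀ i, Continuous (U i) := fun i =>
    continuous_iff_continuousAt.2 fun x => (hU i x).continuousAt
  apply tendstoContinuously_of_tendstoUniformlyOn hcU₀
  obtain ⟨K, hK⟩ := isCompact_Icc.exists_bound_of_continuousOn
    (hA₀.continuousOn (s := Icc (0 : ℝ) 1))
  obtain ⟨C, hC⟩ := isCompact_Icc.exists_bound_of_continuousOn
    (hcU₀.continuousOn (s := Icc (0 : ℝ) 1))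
  have hK0 : 0 ≤ K := (norm_nonneg _).trans (hK 0 (by simp))
  have hC0 : 0 ≤ C := (norm_nonneg _).trans (hC 0 (by simp))
  rw [Metric.tendstoUniformlyOn_iff]
  intro r hr
  -- `e` bounds the coefficient error and `e * C` the resulting forcing of the difference `U i -
  -- U₀`. The Gronwall bound is continuous in the forcing and zero without it; `e < 1` keeps the
  -- coefficients below `K + 1`.
  have hlim : Tendsto (fun e : ℝ => gronwallBound 0 (K + 1) (e * C) 1) (𝓝[>] 0) (𝓝 0) := by
    have h1 : Continuous fun e : ℝ => gronwallBound 0 (K + 1) (e * C) 1 :=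
      (gronwallBound_continuous_ε 0 (K + 1) 1).comp (continuous_id.mul continuous_const)
    have h2 := h1.tendsto 0
    simp only [zero_mul, gronwallBound_ε0_δ0] at h2
    exact h2.mono_left nhdsWithin_le_nhds
  obtain ⟨e, he, he0, he1⟩ := ((hlim.eventually (gt_mem_nhds hr)).and
    (Ioo_mem_nhdsGT (zero_lt_one' ℝ))).exists
  filter_upwards [Metric.tendstoUniformlyOn_iff.1 (hA.tendstoUniformlyOn hA₀) e he0] with i hi
  intro x hx
  have hg := norm_le_gronwallBound_of_norm_deriv_right_le (f := fun x => U i x - U₀ x)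
    (f' := fun x => A i x * U i x - A₀ x * U₀ x) (δ := 0) (K := K + 1) (ε := e * C) (a := 0)
    (b := 1) ((hcU i).sub hcU₀).continuousOn
    (fun x _ => ((hU i x).sub (hU₀ x)).hasDerivWithinAt) (by simp [hU0, hU₀0]) (fun y hy => ?_)
    x hx
  · rw [dist_comm, dist_eq_norm]
    refine (hg.trans ?_).trans_lt he
    exact gronwallBound_mono le_rfl (by positivity) (by positivity) (by simpa using hx.2)
  · have hy' := Ico_subset_Icc_self hy
    have h1 : ‖A i y - A₀ y‖ ≤ e := by
      rw [← dist_eq_norm, dist_comm]; exact (hi y hy').le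
    have h2 : ‖A i y‖ ≤ K + 1 := by
      have := norm_add_le (A₀ y) (A i y - A₀ y)
      rw [add_sub_cancel] at this
      linarith [hK y hy']
    have h3 : A i y * U i y - A₀ y * U₀ y = A i y * (U i y - U₀ y) + (A i y - A₀ y) * U₀ y := by
      noncomm_ring
    rw [h3]
    refine (norm_add_le _ _).trans (add_le_add ?_ ?_)
    · exact (norm_mul_le _ _).trans (by gcongr)
    · exact (norm_mul_le _ _).trans (by gcongr; exact hC y hy')

variable [CompleteSpace 𝔸]

theorem hasDerivAt_picardIterate_succ {A : ℝ → 𝔸} (hA : Continuous A) (n : ℕ) (x : ℝ) :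
    HasDerivAt (picardIterate A (n + 1)) (A x * picardIterate A n x) x :=
  intervalIntegral.integral_hasDerivAt_right
    ((hA.mul (continuous_picardIterate hA n)).intervalIntegrable _ _)
    ((hA.mul (continuous_picardIterate hA n)).stronglyMeasurableAtFilter _ _)
    (hA.mul (continuous_picardIterate hA n)).continuousAt

theorem exists_linearODE_solution {A : ℝ → 𝔸} (hA : Continuous A) :
    ∃ U : ℝ → 𝔸, U 0 = 1 ∧ ∀ x, HasDerivAt U (A x * U x) x := by
  have hbound : ∀ T : ℝ, ∃ K, 0 ≤ K ∧ ∀ x, |x| ≤ T → ‖A x‖ ≤ K := by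
    intro T
    obtain ⟨K, hK⟩ := (isCompact_closedBall (0 : ℝ) T).exists_bound_of_continuousOn
      hA.continuousOn
    refine ⟨max K 0, le_max_right _ _, fun x hx => (hK x ?_).trans (le_max_left _ _)⟩
    simpa using hx
  have hsum : ∀ x, Summable fun n => picardIterate A n x := by
    intro x
    obtain ⟨K, -, hK⟩ := hbound |x|
    refine Summable.of_norm_bounded (g := fun n : ℕ => ‖(1 : 𝔸)‖ * ((K * |x|) ^ n / n.factorial))
      ((Real.summable_pow_div_factorial _).mul_left _) fun n => ?_
    rw [← mul_div_assoc]
    exact norm_picardIterate_le hK n le_rfl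
  -- The constant zeroth iterate is split off so that every remaining term has derivative `A` times
  -- the previous iterate. Termwise differentiation then reproduces the whole series.
  refine ⟨fun x => 1 + ∑' n, picardIterate A (n + 1) x, ?_, fun x => ?_⟩
  · simp [picardIterate]
  · obtain ⟨K, hK0, hK⟩ := hbound (|x| + 1)
    have hd := hasDerivAt_tsum_of_isPreconnected
      (u := fun n : ℕ => K * (‖(1 : 𝔸)‖ * ((K * (|x| + 1)) ^ n / n.factorial)))
      (t := Metric.ball (0 : ℝ) (|x| + 1)) (y₀ := x) (y := x)
      (g := fun n => picardIterate A (n + 1)) (g' := fun n x => A x * picardIterate A n x)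
      (((Real.summable_pow_div_factorial _).mul_left _).mul_left _) Metric.isOpen_ball
      (convex_ball _ _).isPreconnected (fun n y _ => hasDerivAt_picardIterate_succ hA n y)
      (fun n y hy => ?_) (by simp) ((summable_nat_add_iff 1).2 (hsum x)) (by simp)
    · have h1 : (1 : 𝔸) + ∑' n, picardIterate A (n + 1) x = ∑' n, picardIterate A n x := by
        rw [(hsum x).tsum_eq_zero_add]; rfl
      change HasDerivAt _ (A x * (1 + ∑' n, picardIterate A (n + 1) x)) x
      rw [h1, ← (hsum x).tsum_mul_left]
      exact hd.const_add 1
    · have hy' : |y| ≤ |x| + 1 := by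
        have := hy
        simp only [Metric.mem_ball, dist_zero_right, Real.norm_eq_abs] at this
        exact this.le
      refine (norm_mul_le _ _).trans ?_
      gcongr
      · exact hK y hy'
      · rw [← mul_div_assoc]
        refine (norm_picardIterate_le hK n hy').trans ?_
        gcongr

end BanachAlgebra

/-! ### Fundamental matrices -/

/-- `U` is the fundamental matrix of `y' = A(x) y`, normalized at `0`. -/
structure IsFundamental {n : ℕ} {𝕜 : Type*} [RCLike 𝕜] (A : ℝ → Matrix (Fin n) (Fin n) 𝕜)
    (U : ℝ → Matrix (Fin n) (Fin n) 𝕜) : Prop where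
  zero : U 0 = 1
  hasDerivAt : ∀ x i j, HasDerivAt (fun y => U y i j) ((A x * U x) i j) x

attribute [local instance] Matrix.linftyOpNormedRing Matrix.linftyOpNormedAlgebra

theorem hasDerivAt_matrix_iff {n : ℕ} {𝕜 : Type*} [RCLike 𝕜] {U : ℝ → Matrix (Fin n) (Fin n) 𝕜}
    {U' : Matrix (Fin n) (Fin n) 𝕜} {x : ℝ} :
    HasDerivAt U U' x ↔ ∀ i j, HasDerivAt (fun y => U y i j) (U' i j) x := by
  constructor
  · intro h i j
    exact (LinearMap.toContinuousLinearMap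
      (Matrix.entryLinearMap ℝ 𝕜 i j : Matrix (Fin n) (Fin n) 𝕜 →ₗ[ℝ] 𝕜)).hasFDerivAt.comp_hasDerivAt x h
  · intro h
    have h1 : ∀ i j, HasDerivAt (fun y => Matrix.single i j (U y i j))
        (Matrix.single i j (U' i j)) x := fun i j =>
      (LinearMap.toContinuousLinearMap
        (Matrix.singleLinearMap ℝ i j : 𝕜 →ₗ[ℝ] Matrix (Fin n) (Fin n) 𝕜)).hasFDerivAt.comp_hasDerivAt
          x (h i j)
    have h2 := HasDerivAt.fun_sum (u := Finset.univ) fun i _ =>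
      HasDerivAt.fun_sum (u := Finset.univ) fun j _ => h1 i j
    convert! h2 using 1
    · ext1 y; exact Matrix.matrix_eq_sum_single _
    · exact Matrix.matrix_eq_sum_single _

theorem exists_isFundamental {n : ℕ} {𝕜 : Type*} [RCLike 𝕜] {A : ℝ → Matrix (Fin n) (Fin n) 𝕜}
    (hA : Continuous A) : ∃ U, IsFundamental A U := by
  obtain ⟨U, h0, h⟩ := exists_linearODE_solution hA
  exact ⟨U, h0, fun x => hasDerivAt_matrix_iff.1 (h x)⟩

theorem IsFundamental.tendstoContinuously {n : ℕ} {𝕜 : Type*} [RCLike 𝕜] {ι : Type*} {l : Filter ι}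
    {A U : ι → ℝ → Matrix (Fin n) (Fin n) 𝕜} {A₀ U₀ : ℝ → Matrix (Fin n) (Fin n) 𝕜}
    (hA₀ : Continuous A₀) (hA : TendstoContinuously l A A₀)
    (hU : ∀ i, IsFundamental (A i) (U i)) (hU₀ : IsFundamental A₀ U₀) :
    TendstoContinuously l U U₀ :=
  tendstoContinuously_linearODE_solution hA₀ hA (fun i => (hU i).zero)
    (fun i x => hasDerivAt_matrix_iff.2 ((hU i).hasDerivAt x)) hU₀.zero
    (fun x => hasDerivAt_matrix_iff.2 (hU₀.hasDerivAt x))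


/-! ### Hill's equation and its Wronskian -/

/-- `f` solves `f'' = 2 w f`, with derivative `f'`. -/
structure IsHillSolution {𝕜 : Type*} [RCLike 𝕜] (w f f' : ℝ → 𝕜) : Prop where
  hasDerivAt : ∀ x, HasDerivAt f (f' x) x
  hasDerivAt' : ∀ x, HasDerivAt f' (2 * w x * f x) x

section Hill

variable {𝕜 : Type*} [RCLike 𝕜] {w f f' g g' : ℝ → 𝕜}

theorem IsHillSolution.continuous (hf : IsHillSolution w f f') : Continuous f :=
  continuous_iff_continuousAt.2 fun x => (hf.hasDerivAt x).continuousAt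

theorem IsHillSolution.wronskian_eq (hf : IsHillSolution w f f') (hg : IsHillSolution w g g')
    (x : ℝ) : f x * g' x - f' x * g x = f 0 * g' 0 - f' 0 * g 0 := by
  have h : ∀ y, HasDerivAt (fun y => f y * g' y - f' y * g y) 0 y := fun y => by
    convert! ((hf.hasDerivAt y).mul (hg.hasDerivAt' y)).sub
      ((hf.hasDerivAt' y).mul (hg.hasDerivAt y)) using 1
    ring
  exact is_const_of_deriv_eq_zero (fun y => (h y).differentiableAt) (fun y => (h y).deriv) x 0

/-- `(a, b)` is the pair of solutions of `f'' = 2 w f` normalized at `0`. -/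
structure IsHillBasis (w a a' b b' : ℝ → 𝕜) : Prop where
  left : IsHillSolution w a a'
  right : IsHillSolution w b b'
  left_zero : a 0 = 1
  left_zero' : a' 0 = 0
  right_zero : b 0 = 0
  right_zero' : b' 0 = 1

variable {a a' b b' : ℝ → 𝕜}

theorem IsHillBasis.wronskian (h : IsHillBasis w a a' b b') (x : ℝ) :
    a x * b' x - a' x * b x = 1 := by
  rw [h.left.wronskian_eq h.right, h.left_zero, h.left_zero', h.right_zero, h.right_zero']
  ring

theorem IsHillBasis.eq_combination (h : IsHillBasis w a a' b b') (hf : IsHillSolution w f f')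
    (x : ℝ) : f x = f 0 * a x + f' 0 * b x ∧ f' x = f 0 * a' x + f' 0 * b' x := by
  have h1 := h.wronskian x
  have h2 := hf.wronskian_eq h.left x
  have h3 := hf.wronskian_eq h.right x
  rw [h.left_zero, h.left_zero'] at h2
  rw [h.right_zero, h.right_zero'] at h3
  constructor
  · linear_combination (-f x) * h1 + a x * h3 - b x * h2
  · linear_combination (-f' x) * h1 + a' x * h3 - b' x * h2

end Hill

theorem exists_isHillBasis {w : ℝ → ℝ} (hw : Continuous w) :
    ∃ a a' b b', IsHillBasis w a a' b b' := by
  have hc : Continuous fun x => (!![0, 1; 2 * w x, 0] : Matrix (Fin 2) (Fin 2) ℝ) := by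
    refine continuous_matrix fun i j => ?_
    fin_cases i <;> fin_cases j <;> simp <;> fun_prop
  obtain ⟨U, hU⟩ := exists_isFundamental hc
  have h := hU.hasDerivAt
  refine ⟨fun x => U x 0 0, fun x => U x 1 0, fun x => U x 0 1, fun x => U x 1 1,
    ⟨fun x => ?_, fun x => ?_⟩, ⟨fun x => ?_, fun x => ?_⟩, ?_, ?_, ?_, ?_⟩
  · simpa [Matrix.mul_apply, Fin.sum_univ_two] using h x 0 0
  · simpa [Matrix.mul_apply, Fin.sum_univ_two] using h x 1 0
  · simpa [Matrix.mul_apply, Fin.sum_univ_two] using h x 0 1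
  · simpa [Matrix.mul_apply, Fin.sum_univ_two] using h x 1 1
  all_goals simp [hU.zero]

theorem IsHillBasis.isFundamental {w a a' b b' : ℝ → ℝ} (h : IsHillBasis w a a' b b') :
    IsFundamental (fun x => !![0, 1; 2 * w x, 0]) (fun x => !![a x, b x; a' x, b' x]) := by
  refine ⟨?_, fun x i j => ?_⟩
  · ext i j
    fin_cases i <;> fin_cases j <;>
      simp [h.left_zero, h.left_zero', h.right_zero, h.right_zero']
  · fin_cases i <;> fin_cases j <;> simp [Matrix.mul_apply, Fin.sum_univ_two]
    · exact h.left.hasDerivAt x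
    · exact h.right.hasDerivAt x
    · exact h.left.hasDerivAt' x
    · exact h.right.hasDerivAt' x

theorem IsHillBasis.tendstoContinuously {ι : Type*} {l : Filter ι} {w a a' b b' : ι → ℝ → ℝ}
    {w₀ a₀ a₀' b₀ b₀' : ℝ → ℝ} (hw₀ : Continuous w₀) (hw : TendstoContinuously l w w₀)
    (h : ∀ i, IsHillBasis (w i) (a i) (a' i) (b i) (b' i))
    (h₀ : IsHillBasis w₀ a₀ a₀' b₀ b₀') :
    TendstoContinuously l (fun i x => !![a i x, b i x; a' i x, b' i x])
      (fun x => !![a₀ x, b₀ x; a₀' x, b₀' x]) := by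
  have hc : Continuous fun r : ℝ => (!![0, 1; 2 * r, 0] : Matrix (Fin 2) (Fin 2) ℝ) := by
    refine continuous_matrix fun i j => ?_
    fin_cases i <;> fin_cases j <;> simp <;> fun_prop
  exact IsFundamental.tendstoContinuously (hc.comp hw₀) (hw.comp hc)
    (fun i => (h i).isFundamental) h₀.isFundamental

/-! ### Variation of the trace -/

/-- Variation of the trace of the period map with the potential. -/
theorem IsHillBasis.trace_sub_trace {w W a a' b b' A A' B B' : ℝ → ℝ}
    (hw : Continuous w) (hW : Continuous W)
    (h : IsHillBasis w a a' b b') (H : IsHillBasis W A A' B B') :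
    (A 1 + B' 1) - (a 1 + b' 1) =
      ∫ x in (0 : ℝ)..1, 2 * (W x - w x) *
        (b 1 * (a x * A x) + (b' 1 * (a x * B x) - a 1 * (b x * A x)) - a' 1 * (b x * B x)) := by
  -- The differentiated function is the trace of `U_w(1) U_w(x)⁻¹ U_W(x)`, with `U_w` and `U_W` the
  -- fundamental matrices for `w` and `W`. It equals the trace for `w` at `x = 0` and the trace for
  -- `W` at `x = 1`.
  have hd : ∀ x, HasDerivAt (fun x => a 1 * (b' x * A x - b x * A' x)
      + b 1 * (a x * A' x - a' x * A x) + a' 1 * (b' x * B x - b x * B' x)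
      + b' 1 * (a x * B' x - a' x * B x)) (2 * (W x - w x) *
        (b 1 * (a x * A x) + (b' 1 * (a x * B x) - a 1 * (b x * A x)) - a' 1 * (b x * B x))) x := by
    intro x
    have e1 := h.left.hasDerivAt x
    have e2 := h.left.hasDerivAt' x
    have e3 := h.right.hasDerivAt x
    have e4 := h.right.hasDerivAt' x
    have E1 := H.left.hasDerivAt x
    have E2 := H.left.hasDerivAt' x
    have E3 := H.right.hasDerivAt x
    have E4 := H.right.hasDerivAt' x
    convert! ((((((e4.mul E1).sub (e3.mul E2)).const_mul (a 1)).add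
      (((e1.mul E2).sub (e2.mul E1)).const_mul (b 1))).add
      (((e4.mul E3).sub (e3.mul E4)).const_mul (a' 1))).add
      (((e1.mul E4).sub (e2.mul E3)).const_mul (b' 1))) using 1
    ring
  have hc := h.left.continuous
  have hc1 := h.right.continuous
  have hc2 := H.left.continuous
  have hc3 := H.right.continuous
  rw [intervalIntegral.integral_eq_sub_of_hasDerivAt (fun x _ => hd x)
    (Continuous.intervalIntegrable (by fun_prop) _ _), h.left_zero, h.left_zero', h.right_zero,
    h.right_zero', H.left_zero, H.left_zero', H.right_zero, H.right_zero']
  have e1 := h.wronskian 1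
  linear_combination (-(A 1) - B' 1) * e1

/-- Because the variation formula is exact, the factor `τ` comes out of the integral with no
differentiability in the parameter. The remaining integrand converges by continuous dependence, even
when the base potential `w` moves with the parameter as well. -/
theorem exists_trace_quotient {ι : Type*} {l : Filter ι} [l.IsCountablyGenerated]
    {w d a a' b b' A A' B B' : ι → ℝ → ℝ} {τ : ι → ℝ} {w₀ d₀ a₀ a₀' b₀ b₀' : ℝ → ℝ}
    (hwc : ∀ i, Continuous (w i)) (hdc : ∀ i, Continuous (d i))
    (hw₀ : Continuous w₀) (hd₀ : Continuous d₀)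
    (hw : TendstoContinuously l w w₀) (hd : TendstoContinuously l d d₀) (hτ : Tendsto τ l (𝓝 0))
    (h : ∀ i, IsHillBasis (w i) (a i) (a' i) (b i) (b' i))
    (H : ∀ i, IsHillBasis (fun x => w i x + τ i * d i x) (A i) (A' i) (B i) (B' i))
    (h₀ : IsHillBasis w₀ a₀ a₀' b₀ b₀') :
    ∃ I : ι → ℝ, (∀ i, (A i 1 + B' i 1) - (a i 1 + b' i 1) = τ i * I i) ∧
      Tendsto I l (𝓝 (∫ x in (0 : ℝ)..1, 2 * d₀ x *
        (b₀ 1 * a₀ x ^ 2 + (b₀' 1 - a₀ 1) * (a₀ x * b₀ x) - a₀' 1 * b₀ x ^ 2))) ∧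
      Tendsto (fun i => A i 1 + B' i 1) l (𝓝 (a₀ 1 + b₀' 1)) := by
  have hW : TendstoContinuously l (fun i x => w i x + τ i * d i x) w₀ := by
    have h1 := (hw.prodMk ((tendstoContinuously_of_tendsto hτ).prodMk hd)).comp
      (g := fun p : ℝ × ℝ × ℝ => p.1 + p.2.1 * p.2.2) (by fun_prop)
    simpa using h1
  have t1 := IsHillBasis.tendstoContinuously hw₀ hw h h₀
  have t2 := IsHillBasis.tendstoContinuously hw₀ hW H h₀
  have c1 : ∀ i, Continuous (a i) := fun i => (h i).left.continuous
  have c2 : ∀ i, Continuous (b i) := fun i => (h i).right.continuous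
  have c3 : ∀ i, Continuous (A i) := fun i => (H i).left.continuous
  have c4 : ∀ i, Continuous (B i) := fun i => (H i).right.continuous
  have c5 := h₀.left.continuous
  have c6 := h₀.right.continuous
  have one_mem : (1 : ℝ) ∈ Icc (0 : ℝ) 1 := by simp
  refine ⟨fun i => ∫ x in (0 : ℝ)..1, 2 * d i x * (b i 1 * (a i x * A i x) +
    (b' i 1 * (a i x * B i x) - a i 1 * (b i x * A i x)) - a' i 1 * (b i x * B i x)),
    fun i => ?_, ?_, ?_⟩
  · have hdi := hdc i
    have hwi := hwc i
    rw [(h i).trace_sub_trace (hwc i) (by fun_prop) (H i), ← intervalIntegral.integral_const_mul]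
    congr 1
    ext x
    ring
  · apply TendstoContinuously.tendsto_integral
    · intro i
      have := hdc i
      have := c1 i
      have := c2 i
      have := c3 i
      have := c4 i
      fun_prop
    · fun_prop
    · have t3 := tendstoContinuously_of_tendsto (t1.tendsto_apply one_mem)
      have t4 := (hd.prodMk (t1.prodMk (t2.prodMk t3))).comp
        (g := fun p : ℝ × Matrix (Fin 2) (Fin 2) ℝ × Matrix (Fin 2) (Fin 2) ℝ ×
          Matrix (Fin 2) (Fin 2) ℝ => 2 * p.1 * (p.2.2.2 0 1 * (p.2.1 0 0 * p.2.2.1 0 0) +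
            (p.2.2.2 1 1 * (p.2.1 0 0 * p.2.2.1 0 1) - p.2.2.2 0 0 * (p.2.1 0 1 * p.2.2.1 0 0))
            - p.2.2.2 1 0 * (p.2.1 0 1 * p.2.2.1 0 1))) (by fun_prop)
      have e : ∀ x, b₀ 1 * a₀ x ^ 2 + (b₀' 1 - a₀ 1) * (a₀ x * b₀ x) - a₀' 1 * b₀ x ^ 2 =
          b₀ 1 * (a₀ x * a₀ x) + (b₀' 1 * (a₀ x * b₀ x) - a₀ 1 * (b₀ x * a₀ x)) -
            a₀' 1 * (b₀ x * b₀ x) := fun x => by ring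
      simp only [e]
      exact t4
  · have := (t2.comp (g := fun p : Matrix (Fin 2) (Fin 2) ℝ => p 0 0 + p 1 1)
      (by fun_prop)).tendsto_apply one_mem
    simpa using this

/-! ### Monodromy, bands and band edges -/

theorem isMonodromy_hillSystem_iff {V : ℝ → ℝ} {lam : ℝ} {a a' b b' : ℝ → ℝ}
    (h : IsHillBasis (fun x => V x - lam) a a' b b') (M : Matrix (Fin 2) (Fin 2) ℂ) :
    IsMonodromy (hillSystem V lam) M ↔
      M = !![(a 1 : ℂ), (b 1 : ℂ); (a' 1 : ℂ), (b' 1 : ℂ)] := by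
  have hc : IsHillBasis (fun x => ((V x - lam : ℝ) : ℂ)) (fun x => (a x : ℂ)) (fun x => (a' x : ℂ))
      (fun x => (b x : ℂ)) (fun x => (b' x : ℂ)) := by
    refine ⟨⟨fun x => (h.left.hasDerivAt x).ofReal_comp, fun x => ?_⟩,
      ⟨fun x => (h.right.hasDerivAt x).ofReal_comp, fun x => ?_⟩, ?_, ?_, ?_, ?_⟩
    · simpa using (h.left.hasDerivAt' x).ofReal_comp
    · simpa using (h.right.hasDerivAt' x).ofReal_comp
    · simp [h.left_zero]
    · simp [h.left_zero']
    · simp [h.right_zero]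
    · simp [h.right_zero']
  constructor
  · rintro ⟨U, h0, hU, rfl⟩
    have hs : ∀ j, IsHillSolution (fun x => ((V x - lam : ℝ) : ℂ)) (fun x => U x 0 j)
        (fun x => U x 1 j) := by
      refine fun j => ⟨fun x => ?_, fun x => ?_⟩
      · simpa [hillSystem, Matrix.mul_apply, Fin.sum_univ_two] using hU x 0 j
      · simpa [hillSystem, Matrix.mul_apply, Fin.sum_univ_two] using hU x 1 j
    have e0 := hc.eq_combination (hs 0) 1
    have e1 := hc.eq_combination (hs 1) 1
    simp only [h0] at e0 e1
    ext i j
    fin_cases i <;> fin_cases j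
    · simpa using e0.1
    · simpa using e1.1
    · simpa using e0.2
    · simpa using e1.2
  · rintro rfl
    refine ⟨fun x => !![(a x : ℂ), (b x : ℂ); (a' x : ℂ), (b' x : ℂ)], ?_, fun x i j => ?_, rfl⟩
    · ext i j
      fin_cases i <;> fin_cases j <;>
        simp [h.left_zero, h.left_zero', h.right_zero, h.right_zero']
    · fin_cases i <;> fin_cases j <;> simp [hillSystem, Matrix.mul_apply, Fin.sum_univ_two]
      · exact hc.left.hasDerivAt x
      · exact hc.right.hasDerivAt x
      · simpa using hc.left.hasDerivAt' x
      · simpa using hc.right.hasDerivAt' x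

/-- The determinant is one, so `ρ² - T ρ + 1 = 0` with `T` the trace. For `ρ` on the unit circle,
dividing by `ρ` gives `T = ρ + conj ρ = 2 Re ρ`. -/
theorem abs_trace_le_of_mem_hillSpectrum {V : ℝ → ℝ} {lam : ℝ} {a a' b b' : ℝ → ℝ}
    (h : IsHillBasis (fun x => V x - lam) a a' b b') (hl : lam ∈ hillSpectrum V) :
    |a 1 + b' 1| ≤ 2 := by
  obtain ⟨ρ, hρ, M, hM, hev⟩ := hl
  rw [isMonodromy_hillSystem_iff h] at hM
  obtain ⟨v, hv⟩ := hev.exists_hasEigenvector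
  have h1 := hv.apply_eq_smul
  have hv0 := hv.2
  rw [Matrix.toLin'_apply, hM] at h1
  have e0 : (a 1 : ℂ) * v 0 + b 1 * v 1 = ρ * v 0 := by
    simpa [Matrix.mulVec, dotProduct, Fin.sum_univ_two] using congrFun h1 0
  have e1 : (a' 1 : ℂ) * v 0 + b' 1 * v 1 = ρ * v 1 := by
    simpa [Matrix.mulVec, dotProduct, Fin.sum_univ_two] using congrFun h1 1
  have hw : (a 1 : ℂ) * b' 1 - a' 1 * b 1 = 1 := by exact_mod_cast h.wronskian 1
  have hq : ρ ^ 2 - ((a 1 + b' 1 : ℝ) : ℂ) * ρ + 1 = 0 := by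
    push_cast
    by_cases hv00 : v 0 = 0
    · have hv1 : v 1 ≠ 0 := by
        intro hv1
        apply hv0
        ext i
        fin_cases i <;> simp [hv00, hv1]
      apply mul_right_cancel₀ hv1
      linear_combination (-v 1) * hw - (a' 1 : ℂ) * e0 + (ρ - a 1) * (-1) * e1
    · apply mul_right_cancel₀ hv00
      linear_combination (-v 0) * hw - (b 1 : ℂ) * e1 + (ρ - b' 1) * (-1) * e0
  have hρ' : ρ * (starRingEnd ℂ) ρ = 1 := by
    rw [Complex.mul_conj, Complex.normSq_eq_norm_sq, hρ]; simp
  have hsum : ((a 1 + b' 1 : ℝ) : ℂ) = ρ + (starRingEnd ℂ) ρ := by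
    have hne : ρ ≠ 0 := by rintro rfl; simp at hρ
    apply mul_right_cancel₀ hne
    linear_combination (-1) * hq - hρ'
  rw [Complex.add_conj] at hsum
  have h2 : a 1 + b' 1 = 2 * ρ.re := by exact_mod_cast hsum
  rw [h2, abs_mul, abs_two]
  linarith [Complex.abs_re_le_norm ρ]


section Period

variable {w f f' a a' b b' : ℝ → ℝ} {σ : ℝ}

/-- A nontrivial (anti)periodic solution forces the trace of the period map to be `±2`. -/
theorem IsHillBasis.trace_eq (h : IsHillBasis w a a' b b') (hf : IsHillSolution w f f')
    (hne : f 0 ≠ 0 ∨ f' 0 ≠ 0) (hσ : σ ^ 2 = 1) (h1 : f 1 = σ * f 0) (h1' : f' 1 = σ * f' 0) :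
    a 1 + b' 1 = 2 * σ := by
  obtain ⟨e0, e1⟩ := h.eq_combination hf 1
  have hw := h.wronskian 1
  rw [h1] at e0
  rw [h1'] at e1
  have hq : σ ^ 2 - (a 1 + b' 1) * σ + 1 = 0 := by
    rcases hne with h0 | h0 <;> apply mul_right_cancel₀ h0
    · linear_combination (-f 0) * hw + (σ - b' 1) * e0 + b 1 * e1
    · linear_combination (-f' 0) * hw + a' 1 * e0 + (σ - a 1) * e1
  linear_combination (-σ) * hq + (σ - (a 1 + b' 1)) * hσ

/-- The density of the variation of the trace at a simple band edge. -/
theorem IsHillBasis.exists_density (h : IsHillBasis w a a' b b') (hf : IsHillSolution w f f')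
    (hne : f 0 ≠ 0 ∨ f' 0 ≠ 0) (hσ : σ ^ 2 = 1) (h1 : f 1 = σ * f 0) (h1' : f' 1 = σ * f' 0)
    (hdouble : ¬ (a 1 = σ ∧ b 1 = 0 ∧ a' 1 = 0 ∧ b' 1 = σ)) :
    ∃ c : ℝ, c ≠ 0 ∧ ∀ x,
      b 1 * a x ^ 2 + (b' 1 - a 1) * (a x * b x) - a' 1 * b x ^ 2 = c * f x ^ 2 := by
  have htr := h.trace_eq hf hne hσ h1 h1'
  obtain ⟨e0, e1⟩ := h.eq_combination hf 1
  rw [h1] at e0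
  rw [h1'] at e1
  -- The period matrix has trace `2σ` and determinant one, and it fixes the line of `(f 0, f' 0)`
  -- with eigenvalue `σ`. Its difference from `σ` is therefore nilpotent of rank at most one,
  -- determined by that vector up to the scalar `c`.
  have key : ∃ c, b 1 = c * f 0 ^ 2 ∧ b' 1 - a 1 = 2 * (c * (f 0 * f' 0)) ∧
      a' 1 = -(c * f' 0 ^ 2) := by
    by_cases h0 : f 0 = 0
    · have h0' : f' 0 ≠ 0 := hne.resolve_left (not_not.2 h0)
      refine ⟨-a' 1 / f' 0 ^ 2, ?_, ?_, ?_⟩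
      · rw [h0] at e0 ⊢
        have : b 1 = 0 := by
          apply mul_right_cancel₀ h0'
          linear_combination -e0
        rw [this]; ring
      · rw [h0] at e1 ⊢
        have : b' 1 = σ := by
          apply mul_right_cancel₀ h0'
          linear_combination -e1
        linear_combination 2 * this - htr
      · field_simp
    · refine ⟨b 1 / f 0 ^ 2, ?_, ?_, ?_⟩
      · field_simp
      · field_simp
        linear_combination (2 : ℝ) * e0 + f 0 * htr
      · field_simp
        linear_combination (-f 0) * e1 - f' 0 * e0 - f 0 * f' 0 * htr
  obtain ⟨c, k1, k2, k3⟩ := key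
  refine ⟨c, ?_, fun x => ?_⟩
  -- `c = 0` would make the period matrix `σ` times the identity.
  · rintro rfl
    apply hdouble
    refine ⟨?_, ?_, ?_, ?_⟩ <;> linarith
  · rw [k1, k2, k3, (h.eq_combination hf x).1]
    ring

end Period

theorem intervalIntegral_pow_pos {f : ℝ → ℝ} (hf : Continuous f) {n : ℕ} (hn : Even n)
    {x : ℝ} (hx : x ∈ Icc (0 : ℝ) 1) (hfx : f x ≠ 0) : 0 < ∫ y in (0 : ℝ)..1, f y ^ n := by
  apply intervalIntegral.integral_pos zero_lt_one (hf.pow n).continuousOn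
  · exact fun y _ => hn.pow_nonneg _
  · exact ⟨x, hx, hn.pow_pos hfx⟩

/-- At the end of a band the sign of the density is determined by the side of the band:
`κ = 1` for a lower and `κ = -1` for an upper band edge. -/
theorem density_sign_of_band {V f f' a a' b b' : ℝ → ℝ} {lam σ c κ η : ℝ} (hV : Continuous V)
    (h : IsHillBasis (fun x => V x - lam) a a' b b')
    (hf : IsHillSolution (fun x => V x - lam) f f') (hx : ∃ x ∈ Icc (0 : ℝ) 1, f x ≠ 0)
    (hσ : σ ^ 2 = 1) (htr : a 1 + b' 1 = 2 * σ) (hc : c ≠ 0)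
    (hK : ∀ x, b 1 * a x ^ 2 + (b' 1 - a 1) * (a x * b x) - a' 1 * b x ^ 2 = c * f x ^ 2)
    (hκ : κ ^ 2 = 1) (hη : 0 < η) (hband : ∀ t ∈ Icc 0 η, lam + κ * t ∈ hillSpectrum V) :
    0 < κ * σ * c := by
  -- Adding `-κ t` to the potential raises the energy by `κ t`, which moves it into the band.
  have hex : ∀ t : ℝ, ∃ A A' B B', IsHillBasis (fun x => (V x - lam) + t * (-κ)) A A' B B' :=
    fun t => exists_isHillBasis (by fun_prop)
  choose A A' B B' H using hex
  obtain ⟨I, hI, hlim, -⟩ := exists_trace_quotient (ι := ℝ) (l := 𝓝[>] 0)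
    (w := fun _ x => V x - lam) (d := fun _ _ => -κ) (τ := fun t => t)
    (w₀ := fun x => V x - lam) (d₀ := fun _ => -κ) (fun _ => by fun_prop) (fun _ => by fun_prop)
    (by fun_prop) (by fun_prop) (tendstoContinuously_const (by fun_prop))
    (tendstoContinuously_const (by fun_prop)) nhdsWithin_le_nhds (fun _ => h) H h
  have hle : ∀ᶠ t in 𝓝[>] (0 : ℝ), σ * I t ≤ 0 := by
    filter_upwards [Ioc_mem_nhdsGT hη] with t ht
    have hb : IsHillBasis (fun x => V x - (lam + κ * t)) (A t) (A' t) (B t) (B' t) := by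
      convert! H t using 2
      ring
    have h1 := abs_le.1 (abs_trace_le_of_mem_hillSpectrum hb (hband t ⟨ht.1.le, ht.2⟩))
    have h2 : σ * (A t 1 + B' t 1) ≤ 2 := by
      rcases sq_eq_sq_iff_eq_or_eq_neg.1 (hσ.trans (one_pow 2).symm) with rfl | rfl <;> linarith [h1.1, h1.2]
    have h3 : t * (σ * I t) ≤ 0 := by
      have h4 : t * (σ * I t) = σ * (A t 1 + B' t 1) - 2 * σ ^ 2 := by
        linear_combination (-σ) * hI t - σ * htr
      rw [h4, hσ]
      linarith
    exact nonpos_of_mul_nonpos_right h3 ht.1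
  have hlim' := le_of_tendsto (hlim.const_mul σ) hle
  simp only [hK] at hlim'
  rw [show (fun x => 2 * -κ * (c * f x ^ 2)) = fun x => (-(2 * κ * c)) * f x ^ 2 by ext x; ring,
    intervalIntegral.integral_const_mul] at hlim'
  obtain ⟨x, hx, hfx⟩ := hx
  have hpos := intervalIntegral_pow_pos hf.continuous even_two hx hfx
  have h5 : 0 ≤ κ * σ * c := by
    by_contra hneg
    push Not at hneg
    nlinarith [mul_pos_of_neg_of_neg hneg (neg_neg_of_pos hpos)]
  refine lt_of_le_of_ne h5 (Ne.symm ?_)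
  refine mul_ne_zero (mul_ne_zero ?_ ?_) hc
  · rintro rfl; simp at hκ
  · rintro rfl; simp at hσ


/-! ### Conserved forms of the stability system -/

/-- The indefinite Hermitian form conserved by the stability system for imaginary `μ`. -/
def kreinMatrix : Matrix (Fin 4) (Fin 4) ℂ :=
  !![0, 1, 0, 0; -1, 0, 0, 0; 0, 0, 0, -1; 0, 0, 1, 0]

/-- The alternating bilinear form conserved by the stability system. -/
def wronskianMatrix : Matrix (Fin 4) (Fin 4) ℂ :=
  !![0, 1, 0, 0; -1, 0, 0, 0; 0, 0, 0, 1; 0, 0, -1, 0]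

theorem det_kreinMatrix : kreinMatrix.det = 1 := by
  simp [kreinMatrix, Matrix.det_succ_row_zero, Fin.sum_univ_succ, Fin.succAbove]

theorem det_wronskianMatrix : wronskianMatrix.det = 1 := by
  simp [wronskianMatrix, Matrix.det_succ_row_zero, Fin.sum_univ_succ, Fin.succAbove]

section Stability

variable {V f : ℝ → ℝ} {g ω t : ℝ} {μ : ℂ} {U : ℝ → Matrix (Fin 4) (Fin 4) ℂ}

theorem stabilitySystem_solution (hU : IsFundamental (stabilitySystem V g ω f μ) U) (x : ℝ)
    (j : Fin 4) :
    HasDerivAt (fun y => U y 0 j) (U x 1 j) x ∧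
    HasDerivAt (fun y => U y 1 j)
      (2 * ((V x + 3 * g * f x ^ 2 - ω : ℝ) : ℂ) * U x 0 j + -2 * μ * U x 2 j) x ∧
    HasDerivAt (fun y => U y 2 j) (U x 3 j) x ∧
    HasDerivAt (fun y => U y 3 j)
      (-2 * μ * U x 0 j + 2 * ((V x + g * f x ^ 2 - ω : ℝ) : ℂ) * U x 2 j) x := by
  refine ⟨?_, ?_, ?_, ?_⟩
  · simpa [stabilitySystem, Matrix.mul_apply, Fin.sum_univ_four] using hU.hasDerivAt x 0 j
  · simpa [stabilitySystem, Matrix.mul_apply, Fin.sum_univ_four] using hU.hasDerivAt x 1 j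
  · simpa [stabilitySystem, Matrix.mul_apply, Fin.sum_univ_four] using hU.hasDerivAt x 2 j
  · simpa [stabilitySystem, Matrix.mul_apply, Fin.sum_univ_four] using hU.hasDerivAt x 3 j

theorem transpose_mul_wronskianMatrix_mul
    (hU : IsFundamental (stabilitySystem V g ω f μ) U) (x : ℝ) :
    (U x).transpose * wronskianMatrix * U x = wronskianMatrix := by
  ext i j
  have hd : ∀ y, HasDerivAt (fun y => U y 0 i * U y 1 j - U y 1 i * U y 0 j + U y 2 i * U y 3 j
      - U y 3 i * U y 2 j) 0 y := by
    intro y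
    obtain ⟨p0, p1, p2, p3⟩ := stabilitySystem_solution hU y i
    obtain ⟨q0, q1, q2, q3⟩ := stabilitySystem_solution hU y j
    convert! (((p0.mul q1).sub (p1.mul q0)).add (p2.mul q3)).sub (p3.mul q2) using 1
    ring
  have hc := is_const_of_deriv_eq_zero (fun y => (hd y).differentiableAt)
    (fun y => (hd y).deriv) x 0
  have e : ∀ M : Matrix (Fin 4) (Fin 4) ℂ, (M.transpose * wronskianMatrix * M) i j =
      M 0 i * M 1 j - M 1 i * M 0 j + M 2 i * M 3 j - M 3 i * M 2 j := fun M => by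
    simp [wronskianMatrix, Matrix.mul_apply, Fin.sum_univ_four]
    ring
  rw [e, hc, ← e, hU.zero]
  simp

/-- For imaginary `μ` the coupling `-2μ` changes sign under conjugation. The opposite sign of the
`q` block in `kreinMatrix` compensates for this, so the cross terms cancel. -/
theorem conjTranspose_mul_kreinMatrix_mul
    (hU : IsFundamental (stabilitySystem V g ω f (t * Complex.I)) U) (x : ℝ) :
    (U x).conjTranspose * kreinMatrix * U x = kreinMatrix := by
  ext i j
  have hd : ∀ y, HasDerivAt (fun y => star (U y 0 i) * U y 1 j - star (U y 1 i) * U y 0 j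
      - star (U y 2 i) * U y 3 j + star (U y 3 i) * U y 2 j) 0 y := by
    intro y
    obtain ⟨p0, p1, p2, p3⟩ := stabilitySystem_solution hU y i
    obtain ⟨q0, q1, q2, q3⟩ := stabilitySystem_solution hU y j
    convert! (((p0.star.mul q1).sub (p1.star.mul q0)).sub (p2.star.mul q3)).add
      (p3.star.mul q2) using 1
    simp only [star_add, star_mul', star_neg, RCLike.star_def, Complex.conj_ofReal, Complex.conj_I,
      map_ofNat]
    ring
  have hc := is_const_of_deriv_eq_zero (fun y => (hd y).differentiableAt)
    (fun y => (hd y).deriv) x 0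
  have e : ∀ M : Matrix (Fin 4) (Fin 4) ℂ, (M.conjTranspose * kreinMatrix * M) i j =
      star (M 0 i) * M 1 j - star (M 1 i) * M 0 j - star (M 2 i) * M 3 j
        + star (M 3 i) * M 2 j := fun M => by
    simp [kreinMatrix, Matrix.mul_apply, Fin.sum_univ_four]
    ring
  rw [e, hc, ← e, hU.zero]
  simp

/-- This leaves only the sign of the determinant open; continuity from `μ = 0` settles it for small
`μ`. -/
theorem det_sq_eq_one (hU : IsFundamental (stabilitySystem V g ω f μ) U) (x : ℝ) :
    (U x).det ^ 2 = 1 := by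
  have h := congrArg Matrix.det (transpose_mul_wronskianMatrix_mul hU x)
  rw [Matrix.det_mul, Matrix.det_mul, Matrix.det_transpose, det_wronskianMatrix] at h
  linear_combination h

end Stability

/-! ### Multipliers on the unit circle -/

/-- The characteristic polynomial of `M` at `exp (i θ)`, normalized to be real for
Krein-unitary `M`. -/
noncomputable def circleCharpoly (M : Matrix (Fin 4) (Fin 4) ℂ) (θ : ℝ) : ℂ :=
  Complex.exp (-(θ * Complex.I)) ^ 2 * (M - Complex.exp (θ * Complex.I) • 1).det

theorem continuous_circleCharpoly (M : Matrix (Fin 4) (Fin 4) ℂ) :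
    Continuous (circleCharpoly M) := by
  unfold circleCharpoly
  fun_prop

theorem continuous_circleCharpoly_left (θ : ℝ) :
    Continuous fun M => circleCharpoly M θ := by
  unfold circleCharpoly
  fun_prop

theorem conj_circleCharpoly {M : Matrix (Fin 4) (Fin 4) ℂ} (hdet : M.det = 1)
    (hM : M.conjTranspose * kreinMatrix * M = kreinMatrix) (θ : ℝ) :
    (starRingEnd ℂ) (circleCharpoly M θ) = circleCharpoly M θ := by
  set ρ := Complex.exp (θ * Complex.I) with hρ
  set ρ' := Complex.exp (-(θ * Complex.I)) with hρ'
  have hmul : ρ * ρ' = 1 := by rw [hρ, hρ', ← Complex.exp_add]; simp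
  have hc : (starRingEnd ℂ) ρ = ρ' := by
    rw [hρ, hρ', ← Complex.exp_conj]; simp
  have hc' : (starRingEnd ℂ) ρ' = ρ := by rw [← hc, Complex.conj_conj]
  -- On the unit circle `conj ρ = ρ⁻¹`, so the Krein identity relates `M - ρ` to its adjoint. Taking
  -- determinants produces the factor `ρ⁴`, which the normalization `ρ⁻²` shares evenly between the
  -- two sides.
  have h1 : M.conjTranspose * kreinMatrix * (M - ρ • 1) =
      (-ρ) • ((M - ρ • 1).conjTranspose * kreinMatrix) := by
    have hstar : star ρ = ρ' := hc
    rw [Matrix.mul_sub, hM, Matrix.conjTranspose_sub, Matrix.conjTranspose_smul,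
      Matrix.conjTranspose_one, hstar, Matrix.sub_mul, smul_sub, Matrix.mul_smul, Matrix.mul_one,
      Matrix.smul_mul, Matrix.one_mul, smul_smul, neg_mul, hmul]
    module
  have h2 := congrArg Matrix.det h1
  rw [Matrix.det_mul, Matrix.det_mul, Matrix.det_smul, Matrix.det_mul, Matrix.det_conjTranspose,
    Matrix.det_conjTranspose, hdet, det_kreinMatrix, Fintype.card_fin, star_one] at h2
  have h3 : star ((M - ρ • 1).det) = (starRingEnd ℂ) ((M - ρ • 1).det) := rfl
  rw [h3] at h2
  unfold circleCharpoly
  rw [map_mul, map_pow, ← hρ, ← hρ', hc']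
  linear_combination (-(ρ' ^ 2)) * h2 +
    (-(ρ ^ 2 * (starRingEnd ℂ) ((M - ρ • 1).det)) * (ρ * ρ' + 1)) * hmul

theorem hasEigenvalue_of_circleCharpoly_eq_zero {M : Matrix (Fin 4) (Fin 4) ℂ} {θ : ℝ}
    (h : circleCharpoly M θ = 0) :
    Module.End.HasEigenvalue (Matrix.toLin' M) (Complex.exp (θ * Complex.I)) := by
  have hdet : (M - Complex.exp (θ * Complex.I) • 1).det = 0 :=
    (mul_eq_zero.1 h).resolve_left (pow_ne_zero _ (Complex.exp_ne_zero _))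
  obtain ⟨v, hv, hv0⟩ := Matrix.exists_mulVec_eq_zero_iff.2 hdet
  refine Module.End.hasEigenvalue_of_hasEigenvector (x := v)
    ⟨Module.End.mem_eigenspace_iff.2 ?_, hv⟩
  rw [Matrix.sub_mulVec, Matrix.smul_mulVec, Matrix.one_mulVec, sub_eq_zero] at hv0
  rw [Matrix.toLin'_apply, hv0]

theorem circleCharpoly_block {a b a' b' c d c' d' : ℝ} (hab : a * b' - a' * b = 1)
    (hcd : c * d' - c' * d = 1) (θ : ℝ) :
    circleCharpoly !![(a : ℂ), b, 0, 0; (a' : ℂ), b', 0, 0; 0, 0, (c : ℂ), d; 0, 0, (c' : ℂ), d'] θ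
      = ((2 * Real.cos θ - (a + b')) * (2 * Real.cos θ - (c + d')) : ℝ) := by
  set ρ := Complex.exp (θ * Complex.I) with hρ
  set ρ' := Complex.exp (-(θ * Complex.I)) with hρ'
  have hmul : ρ * ρ' = 1 := by rw [hρ, hρ', ← Complex.exp_add]; simp
  have hcos : 2 * Complex.cos θ = ρ + ρ' := by
    rw [Complex.cos, neg_mul, hρ, hρ']; ring
  have hdet : (!![(a : ℂ), b, 0, 0; (a' : ℂ), b', 0, 0; 0, 0, (c : ℂ), d; 0, 0, (c' : ℂ), d'] -
      ρ • (1 : Matrix (Fin 4) (Fin 4) ℂ)).det =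
      ((a - ρ) * (b' - ρ) - a' * b) * ((c - ρ) * (d' - ρ) - c' * d) := by
    simp [Matrix.det_succ_row_zero, Fin.sum_univ_succ, Fin.succAbove, Matrix.one_apply]
    ring
  have hab' : (a : ℂ) * b' - a' * b = 1 := by exact_mod_cast hab
  have hcd' : (c : ℂ) * d' - c' * d = 1 := by exact_mod_cast hcd
  unfold circleCharpoly
  rw [← hρ, ← hρ', hdet]
  push_cast
  rw [hcos]
  have e1 : ρ' * ((a - ρ) * (b' - ρ) - a' * b) = ρ + ρ' - (a + b') := by
    linear_combination ρ' * hab' + (ρ - (a + b')) * hmul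
  have e2 : ρ' * ((c - ρ) * (d' - ρ) - c' * d) = ρ + ρ' - (c + d') := by
    linear_combination ρ' * hcd' + (ρ - (c + d')) * hmul
  rw [← e1, ← e2]
  ring

theorem det_block {a b a' b' c d c' d' : ℝ} (hab : a * b' - a' * b = 1)
    (hcd : c * d' - c' * d = 1) :
    (!![(a : ℂ), b, 0, 0; (a' : ℂ), b', 0, 0; 0, 0, (c : ℂ), d; 0, 0, (c' : ℂ), d']).det = 1 := by
  have hab' : (a : ℂ) * b' - a' * b = 1 := by exact_mod_cast hab
  have hcd' : (c : ℂ) * d' - c' * d = 1 := by exact_mod_cast hcd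
  have : (!![(a : ℂ), b, 0, 0; (a' : ℂ), b', 0, 0; 0, 0, (c : ℂ), d; 0, 0, (c' : ℂ), d']).det =
      (a * b' - a' * b) * (c * d' - c' * d) := by
    simp [Matrix.det_succ_row_zero, Fin.sum_univ_succ, Fin.succAbove]
    ring
  rw [this, hab', hcd', one_mul]

theorem IsHillBasis.isFundamental_stabilitySystem {V f : ℝ → ℝ} {g ω : ℝ}
    {a a' b b' c c' d d' : ℝ → ℝ}
    (h : IsHillBasis (fun x => V x + 3 * g * f x ^ 2 - ω) a a' b b')
    (h' : IsHillBasis (fun x => V x + g * f x ^ 2 - ω) c c' d d') :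
    IsFundamental (stabilitySystem V g ω f 0)
      (fun x => !![(a x : ℂ), b x, 0, 0; (a' x : ℂ), b' x, 0, 0; 0, 0, (c x : ℂ), d x;
        0, 0, (c' x : ℂ), d' x]) := by
  refine ⟨?_, fun x i j => ?_⟩
  · ext i j
    fin_cases i <;> fin_cases j <;>
      simp [h.left_zero, h.left_zero', h.right_zero, h.right_zero', h'.left_zero, h'.left_zero',
        h'.right_zero, h'.right_zero']
  · have p0 := (h.left.hasDerivAt x).ofReal_comp
    have p1 := (h.left.hasDerivAt' x).ofReal_comp
    have p2 := (h.right.hasDerivAt x).ofReal_comp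
    have p3 := (h.right.hasDerivAt' x).ofReal_comp
    have q0 := (h'.left.hasDerivAt x).ofReal_comp
    have q1 := (h'.left.hasDerivAt' x).ofReal_comp
    have q2 := (h'.right.hasDerivAt x).ofReal_comp
    have q3 := (h'.right.hasDerivAt' x).ofReal_comp
    push_cast at p1 p3 q1 q3
    fin_cases i <;> fin_cases j <;>
      simp [stabilitySystem, Matrix.mul_apply, Fin.sum_univ_four, hasDerivAt_const] <;> assumption

theorem continuous_stabilitySystem {V f : ℝ → ℝ} (hV : Continuous V) (hf : Continuous f) (g ω : ℝ) :
    Continuous fun p : ℝ × ℝ => stabilitySystem V g ω f (p.1 * Complex.I) p.2 := by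
  refine continuous_matrix fun i j => ?_
  fin_cases i <;> fin_cases j <;> simp [stabilitySystem] <;> fun_prop

/-- If `L₊` is elliptic and `L₋` is parabolic, then the imaginary axis near `0` belongs to the
spectrum of the stability problem. -/
theorem exists_imaginary_interval {V f : ℝ → ℝ} (hV : Continuous V) (hf : Continuous f) {g ω σ : ℝ}
    {a a' b b' c c' d d' : ℝ → ℝ}
    (h : IsHillBasis (fun x => V x + 3 * g * f x ^ 2 - ω) a a' b b')
    (h' : IsHillBasis (fun x => V x + g * f x ^ 2 - ω) c c' d d')
    (htr : |a 1 + b' 1| < 2) (hσ : σ ^ 2 = 1) (htr' : c 1 + d' 1 = 2 * σ) :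
    ∃ η > 0, ∀ t : ℝ, |t| < η → (t : ℂ) * Complex.I ∈ stabilitySpectrum V g ω f := by
  have hcont := continuous_stabilitySystem hV hf g ω
  have hcont₁ : ∀ t : ℝ, Continuous (stabilitySystem V g ω f (t * Complex.I)) := fun t =>
    hcont.comp (f := fun x : ℝ => (t, x)) (by fun_prop)
  have hex : ∀ t : ℝ, ∃ U, IsFundamental (stabilitySystem V g ω f (t * Complex.I)) U :=
    fun t => exists_isFundamental (hcont₁ t)
  choose U hU using hex
  have h0 := h.isFundamental_stabilitySystem h'
  have hlim := IsFundamental.tendstoContinuously (l := 𝓝 (0 : ℝ))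
    (A := fun t => stabilitySystem V g ω f (t * Complex.I)) (A₀ := stabilitySystem V g ω f 0)
    (by simpa using hcont₁ 0) (fun x _ => by
      have := (hcont.tendsto (0, x)).mono_left
        (show 𝓝 (0 : ℝ) ×ˢ 𝓝[Icc (0 : ℝ) 1] x ≤ 𝓝 (0, x) by
          rw [nhds_prod_eq]; exact prod_mono le_rfl nhdsWithin_le_nhds)
      simpa using this) hU h0
  have hM := hlim.tendsto_apply (x := 1) (by simp)
  obtain ⟨hlo, hhi⟩ := abs_lt.1 htr
  set θ := Real.arccos ((a 1 + b' 1) / 2) with hθ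
  have hcosθ : Real.cos θ = (a 1 + b' 1) / 2 := Real.cos_arccos (by linarith) (by linarith)
  have hθ0 : 0 < θ := Real.arccos_pos.2 (by linarith)
  have hθπ : θ < Real.pi := by
    refine lt_of_le_of_ne (Real.arccos_le_pi _) fun (he : θ = Real.pi) => ?_
    rw [he, Real.cos_pi] at hcosθ
    linarith
  have hq : ∀ ψ : ℝ, Tendsto (fun t => (circleCharpoly (U t 1) ψ).re) (𝓝 0)
      (𝓝 ((2 * Real.cos ψ - 2 * Real.cos θ) * (2 * Real.cos ψ - 2 * σ))) := by
    intro ψ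
    have hc : Continuous fun M => (circleCharpoly M ψ).re :=
      Complex.continuous_re.comp (continuous_circleCharpoly_left ψ)
    have h1 := (hc.tendsto _).comp hM
    simp only [Function.comp_def, circleCharpoly_block (h.wronskian 1) (h'.wronskian 1),
      Complex.ofReal_re, htr'] at h1
    rw [hcosθ, mul_div_cancel₀ _ two_ne_zero]
    exact h1
  -- The test angles `θ / 2` and `(θ + π) / 2` lie in `(0, π)` on either side of `θ`. The `L₊`
  -- factor changes sign between them; the `L₋` factor does not, since `|cos| < 1 = |σ|` there.
  have hneg : ((2 * Real.cos (θ / 2) - 2 * Real.cos θ) * (2 * Real.cos (θ / 2) - 2 * σ)) *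
      ((2 * Real.cos ((θ + Real.pi) / 2) - 2 * Real.cos θ) *
        (2 * Real.cos ((θ + Real.pi) / 2) - 2 * σ)) < 0 := by
    have c1 : Real.cos θ < Real.cos (θ / 2) :=
      Real.cos_lt_cos_of_nonneg_of_le_pi (by linarith) hθπ.le (by linarith)
    have c2 : Real.cos ((θ + Real.pi) / 2) < Real.cos θ :=
      Real.cos_lt_cos_of_nonneg_of_le_pi hθ0.le (by linarith) (by linarith)
    have c3 : Real.cos (θ / 2) < 1 := by
      rw [← Real.cos_zero]
      exact Real.cos_lt_cos_of_nonneg_of_le_pi le_rfl (by linarith) (by linarith)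
    have c4 : -1 < Real.cos ((θ + Real.pi) / 2) := by
      rw [← Real.cos_pi]
      exact Real.cos_lt_cos_of_nonneg_of_le_pi (by linarith) le_rfl (by linarith)
    have c5 : 0 < (2 * Real.cos (θ / 2) - 2 * σ) * (2 * Real.cos ((θ + Real.pi) / 2) - 2 * σ) := by
      rcases sq_eq_sq_iff_eq_or_eq_neg.1 (hσ.trans (one_pow 2).symm) with rfl | rfl
      · exact mul_pos_of_neg_of_neg (by linarith) (by linarith)
      · exact mul_pos (by linarith) (by linarith)
    have c6 : (2 * Real.cos (θ / 2) - 2 * Real.cos θ) *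
        (2 * Real.cos ((θ + Real.pi) / 2) - 2 * Real.cos θ) < 0 :=
      mul_neg_of_pos_of_neg (by linarith) (by linarith)
    nlinarith [mul_neg_of_pos_of_neg c5 c6]
  have hev1 := ((hq (θ / 2)).mul (hq ((θ + Real.pi) / 2))).eventually (gt_mem_nhds hneg)
  have hdet : ∀ᶠ t in 𝓝 (0 : ℝ), (U t 1).det ≠ -1 := by
    have h1 := ((continuous_id.matrix_det.tendsto _).comp hM)
    simp only [Function.comp_def, id, det_block (h.wronskian 1) (h'.wronskian 1)] at h1
    exact h1.eventually_ne (by norm_num)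
  obtain ⟨η, hη, hball⟩ := Metric.eventually_nhds_iff.1 (hev1.and hdet)
  refine ⟨η, hη, fun t ht => ?_⟩
  obtain ⟨ht1, ht2⟩ := hball (y := t) (by simpa using ht)
  have hd1 : (U t 1).det = 1 :=
    (sq_eq_sq_iff_eq_or_eq_neg.1 ((det_sq_eq_one (hU t) 1).trans (one_pow 2).symm)).resolve_right ht2
  have hcts : Continuous fun ψ => (circleCharpoly (U t 1) ψ).re :=
    Complex.continuous_re.comp (continuous_circleCharpoly _)
  have hzero : ∃ ψ, (circleCharpoly (U t 1) ψ).re = 0 := by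
    rcases mul_neg_iff.1 ht1 with ⟨k1, k2⟩ | ⟨k1, k2⟩
    · exact mem_range_of_exists_le_of_exists_ge hcts ⟨_, k2.le⟩ ⟨_, k1.le⟩
    · exact mem_range_of_exists_le_of_exists_ge hcts ⟨_, k1.le⟩ ⟨_, k2.le⟩
  obtain ⟨ψ, hψ⟩ := hzero
  -- The intermediate value theorem gives a zero of the real part, and the Krein symmetry kills the
  -- imaginary part.
  have hz : circleCharpoly (U t 1) ψ = 0 :=
    Complex.ext hψ (Complex.conj_eq_iff_im.1
      (conj_circleCharpoly hd1 (conjTranspose_mul_kreinMatrix_mul (hU t) 1) ψ))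
  exact ⟨Complex.exp (ψ * Complex.I), Complex.norm_exp_ofReal_mul_I ψ, U t 1,
    ⟨U t, (hU t).zero, (hU t).hasDerivAt, rfl⟩, hasEigenvalue_of_circleCharpoly_eq_zero hz⟩


/-! ### The family of standing waves -/

/-- The positivity of the integrals needs a nonzero value inside the period interval. A solution
vanishing on `[0, 1]` has zero data at the interior point `1/2`, and the Wronskians carry this back
to `0`. -/
theorem IsHillBasis.exists_ne_zero {w f f' a a' b b' : ℝ → ℝ} (h : IsHillBasis w a a' b b')
    (hf : IsHillSolution w f f') (hne : f 0 ≠ 0 ∨ f' 0 ≠ 0) : ∃ x ∈ Icc (0 : ℝ) 1, f x ≠ 0 := by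
  by_contra! hz
  have h0 : f (1 / 2) = 0 := hz _ (by norm_num)
  have h1 : f' (1 / 2) = 0 := by
    have he : f =ᶠ[𝓝 (1 / 2)] fun _ => 0 := by
      filter_upwards [Icc_mem_nhds (show (0 : ℝ) < 1 / 2 by norm_num)
        (show (1 / 2 : ℝ) < 1 by norm_num)] with x hx using hz x hx
    exact (hf.hasDerivAt _).unique ((hasDerivAt_const _ _).congr_of_eventuallyEq he)
  have e1 := hf.wronskian_eq h.left (1 / 2)
  have e2 := hf.wronskian_eq h.right (1 / 2)
  rw [h0, h1, h.left_zero, h.left_zero'] at e1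
  rw [h0, h1, h.right_zero, h.right_zero'] at e2
  rcases hne with hne | hne <;> apply hne <;> linarith

theorem IsStandingWave.isHillSolution {V f : ℝ → ℝ} {g ω : ℝ} (h : IsStandingWave V g ω f) :
    IsHillSolution (fun x => V x + g * f x ^ 2 - ω) f (deriv f) := by
  refine ⟨fun x => ?_, fun x => ?_⟩
  · exact (h.1.differentiable (by norm_num) x).hasDerivAt
  · have hd : ContDiff ℝ 1 (deriv f) := by
      have h2 : ContDiff ℝ (1 + 1) f := by simpa [one_add_one_eq_two] using h.1
      exact (contDiff_succ_iff_deriv.1 h2).2.2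
    convert! (hd.differentiable (by norm_num) x).hasDerivAt using 1
    linear_combination (-2) * h.2 x

/-- The derivative in `x` of a jointly smooth function of `(x, ε)`. -/
theorem contDiffOn_partial_deriv {φ : ℝ → ℝ → ℝ} {n : WithTop ℕ∞} {I : Set ℝ} (hI : IsOpen I)
    (h : ContDiffOn ℝ (n + 1) (fun z : ℝ × ℝ => φ z.1 z.2) (univ ×ˢ I)) :
    ContDiffOn ℝ n (fun z : ℝ × ℝ => deriv (fun x => φ x z.2) z.1) (univ ×ˢ I) := by
  have hD : IsOpen ((univ : Set ℝ) ×ˢ I) := isOpen_univ.prod hI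
  have h1 := (h.fderiv_of_isOpen hD le_rfl).clm_apply
    (contDiffOn_const (c := ((1 : ℝ), (0 : ℝ))))
  refine h1.congr fun z hz => ?_
  have hF := ((h.contDiffAt (hD.mem_nhds hz)).differentiableAt (by simp)).hasFDerivAt
  have hl : HasDerivAt (fun x : ℝ => (x, z.2)) ((1 : ℝ), (0 : ℝ)) z.1 :=
    (hasDerivAt_id _).prodMk (hasDerivAt_const _ _)
  exact (hF.comp_hasDerivAt z.1 hl).deriv

section Family

variable {V : ℝ → ℝ} {s δ : ℝ} {φ : ℝ → ℝ → ℝ} {ω : ℝ → ℝ}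

/-- No regularity of `ω` is assumed. At a point `x` with `φ x 0 ≠ 0` the wave equation can be solved
for `ω ε`, and joint `C²` smoothness makes the resulting quotient continuous. -/
theorem IsStandingWaveFamily.continuousAt_frequency (hδ : 0 < δ)
    (h : IsStandingWaveFamily V s δ φ ω) : ContinuousAt ω 0 := by
  obtain ⟨x, hx⟩ := h.nontrivial
  have hD : IsOpen ((univ : Set ℝ) ×ˢ Ioo (-δ) δ) := isOpen_univ.prod isOpen_Ioo
  have hmem : (x, (0 : ℝ)) ∈ (univ : Set ℝ) ×ˢ Ioo (-δ) δ := by simp [hδ]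
  have h2 : ContDiffOn ℝ (0 + 1 + 1) (fun z : ℝ × ℝ => φ z.1 z.2) (univ ×ˢ Ioo (-δ) δ) := by
    simpa [one_add_one_eq_two] using h.contDiffOn
  have h3 := contDiffOn_partial_deriv (φ := fun x ε => deriv (fun x => φ x ε) x) isOpen_Ioo
    (contDiffOn_partial_deriv isOpen_Ioo h2)
  have hl : ContinuousAt (fun ε : ℝ => (x, ε)) 0 := by fun_prop
  have c0 : ContinuousAt (fun ε => φ x ε) 0 :=
    (h.contDiffOn.continuousOn.continuousAt (hD.mem_nhds hmem)).comp hl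
  have c2 : ContinuousAt (fun ε => deriv (deriv fun y => φ y ε) x) 0 :=
    (h3.continuousOn.continuousAt (hD.mem_nhds hmem)).comp hl
  have hcont : ContinuousAt (fun ε => (-(1 / 2) * deriv (deriv fun y => φ y ε) x
      + (s * ε) * φ x ε ^ 3 + V x * φ x ε) / φ x ε) 0 := by
    refine ContinuousAt.div ?_ c0 hx
    exact ((continuousAt_const.mul c2).add ((continuousAt_const.mul continuousAt_id).mul
      (c0.pow 3))).add (continuousAt_const.mul c0)
  refine hcont.congr ?_
  filter_upwards [c0.eventually_ne hx, Ioo_mem_nhds (neg_lt_zero.2 hδ) hδ] with ε hε hmε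
  rw [← (h.standing_wave ε hmε).2 x, mul_div_cancel_right₀ _ hε]

theorem IsStandingWaveFamily.exists_multiplier (h : IsStandingWaveFamily V s δ φ ω) :
    ∃ σ : ℝ, σ ^ 2 = 1 ∧ ∀ ε ∈ Ioo (-δ) δ, φ 1 ε = σ * φ 0 ε ∧
      deriv (fun x => φ x ε) 1 = σ * deriv (fun x => φ x ε) 0 := by
  have key : ∀ (f : ℝ → ℝ) (σ : ℝ), (∀ x, f (x + 1) = σ * f x) →
      f 1 = σ * f 0 ∧ deriv f 1 = σ * deriv f 0 := by
    intro f σ hf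
    refine ⟨by simpa using hf 0, ?_⟩
    have h1 : deriv (fun x => f (x + 1)) 0 = deriv f (0 + 1) := deriv_comp_add_const _ _ _
    rw [zero_add] at h1
    rw [← h1, funext hf, deriv_const_mul_field]
  rcases h.periodic_or_antiperiodic with hp | hp
  · exact ⟨1, one_pow 2, fun ε hε => key (fun x => φ x ε) 1 fun x => by simpa using hp ε hε x⟩
  · exact ⟨-1, by norm_num, fun ε hε => key (fun x => φ x ε) (-1) fun x => by simpa using hp ε hε x⟩

theorem IsStandingWaveFamily.exists_imaginary_spectrum (hV : Continuous V) (hδ : 0 < δ)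
    (h : IsStandingWaveFamily V s δ φ ω) (hdouble : ¬ IsDoublePoint V (ω 0)) {κ η : ℝ}
    (hκ : κ ^ 2 = 1) (hη : 0 < η) (hband : ∀ t ∈ Icc 0 η, ω 0 + κ * t ∈ hillSpectrum V) :
    ∃ ε₀ > 0, ε₀ ≤ δ ∧ ∀ ε : ℝ, |ε| < ε₀ → κ * (s * ε) < 0 →
      ∃ η > 0, ∀ t : ℝ, |t| < η →
        (t : ℂ) * Complex.I ∈ stabilitySpectrum V (s * ε) (ω ε) (fun x => φ x ε) := by
  obtain ⟨σ, hσ, hper⟩ := h.exists_multiplier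
  have h0mem : (0 : ℝ) ∈ Ioo (-δ) δ := by simp [hδ]
  have hD : IsOpen ((univ : Set ℝ) ×ˢ Ioo (-δ) δ) := isOpen_univ.prod isOpen_Ioo
  have hφc : ∀ ε ∈ Ioo (-δ) δ, Continuous fun x => φ x ε := fun ε hε =>
    (h.standing_wave ε hε).1.continuous
  have hsol := fun ε (hε : ε ∈ Ioo (-δ) δ) => (h.standing_wave ε hε).isHillSolution
  have hsol₀ : IsHillSolution (fun x => V x - ω 0) (fun x => φ x 0) (deriv fun x => φ x 0) := by
    simpa using hsol 0 h0mem
  obtain ⟨a₀, a₀', b₀, b₀', h₀⟩ := exists_isHillBasis (w := fun x => V x - ω 0) (by fun_prop)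
  obtain ⟨x₁, hx₁⟩ := h.nontrivial
  have hne_of : ∀ {w a a' b b' f f' : ℝ → ℝ}, IsHillBasis w a a' b b' → IsHillSolution w f f' →
      f x₁ ≠ 0 → f 0 ≠ 0 ∨ f' 0 ≠ 0 := by
    intro w a a' b b' f f' hb hf hx
    by_contra! hz
    exact hx (by rw [(hb.eq_combination hf x₁).1, hz.1, hz.2]; ring)
  have hne₀ := hne_of h₀ hsol₀ hx₁
  obtain ⟨hp₀, hp₀'⟩ := hper 0 h0mem
  obtain ⟨c, hc, hK⟩ := h₀.exists_density hsol₀ hne₀ hσ hp₀ hp₀' (by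
    rintro ⟨e1, e2, e3, e4⟩
    apply hdouble
    unfold IsDoublePoint
    rw [isMonodromy_hillSystem_iff h₀, isMonodromy_hillSystem_iff h₀, e1, e2, e3, e4]
    rcases sq_eq_sq_iff_eq_or_eq_neg.1 (hσ.trans (one_pow 2).symm) with rfl | rfl
    · left; ext i j; fin_cases i <;> fin_cases j <;> simp
    · right; ext i j; fin_cases i <;> fin_cases j <;> simp)
  have htr₀ := h₀.trace_eq hsol₀ hne₀ hσ hp₀ hp₀'
  obtain ⟨y, hy, hφy⟩ := h₀.exists_ne_zero hsol₀ hne₀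
  have hsign := density_sign_of_band hV h₀ hsol₀ ⟨y, hy, hφy⟩ hσ htr₀ hc hK hκ hη hband
  -- The waves are controlled only for `|ε| < δ`; indexing by this subtype provides continuous
  -- potentials, hence bases, for every index.
  let ι := Ioo (-δ) δ
  let z : ι := ⟨0, h0mem⟩
  have hτ : Tendsto (fun ε : ι => s * (ε : ℝ)) (𝓝 z) (𝓝 0) := by
    have : Continuous fun ε : ι => s * (ε : ℝ) := by fun_prop
    simpa [z] using this.tendsto z
  have hφt : TendstoContinuously (𝓝 z) (fun (ε : ι) x => φ x ε) (fun x => φ x 0) := by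
    intro x _
    have h1 := (h.contDiffOn.continuousOn.continuousAt
      (hD.mem_nhds (show (x, (0 : ℝ)) ∈ _ by simp [hδ]))).tendsto
    have h2 : Tendsto (fun y : ι × ℝ => (y.2, (y.1 : ℝ))) (𝓝 z ×ˢ 𝓝[Icc (0 : ℝ) 1] x)
        (𝓝 (x, (0 : ℝ))) :=
      ((tendsto_snd (f := 𝓝 z)).mono_right nhdsWithin_le_nhds).prodMk_nhds
        ((continuous_subtype_val.tendsto z).comp tendsto_fst)
    exact h1.comp h2
  have hωt : Tendsto (fun ε : ι => ω ε) (𝓝 z) (𝓝 (ω 0)) :=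
    (h.continuousAt_frequency hδ).tendsto.comp (continuous_subtype_val.tendsto z)
  have hwt : TendstoContinuously (𝓝 z) (fun (ε : ι) x => V x + (s * ε) * φ x ε ^ 2 - ω ε)
      (fun x => V x - ω 0) := by
    have h1 := ((tendstoContinuously_const (l := 𝓝 z) hV).prodMk
      ((tendstoContinuously_of_tendsto hτ).prodMk
        (hφt.prodMk (tendstoContinuously_of_tendsto hωt)))).comp
      (g := fun p : ℝ × ℝ × ℝ × ℝ => p.1 + p.2.1 * p.2.2.1 ^ 2 - p.2.2.2) (by fun_prop)
    simpa using h1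
  have hdt : TendstoContinuously (𝓝 z) (fun (ε : ι) x => 2 * φ x ε ^ 2)
      (fun x => 2 * φ x 0 ^ 2) := hφt.comp (g := fun r => 2 * r ^ 2) (by fun_prop)
  have hwc : ∀ ε : ι, Continuous fun x => V x + (s * ε) * φ x ε ^ 2 - ω ε := fun ε => by
    have := hφc ε ε.2
    fun_prop
  have hdc : ∀ ε : ι, Continuous fun x => 2 * φ x (ε : ℝ) ^ 2 := fun ε => by
    have := hφc ε ε.2
    fun_prop
  have hφ0c := hφc 0 h0mem
  choose a a' b b' hb using fun ε : ι => exists_isHillBasis (hwc ε)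
  -- The potential of `L₊` is written as that of `L₋` plus `sε · 2φ²`, the form required by the
  -- trace quotient.
  choose A A' B B' hB using fun ε : ι => exists_isHillBasis
    (w := fun x => (V x + (s * ε) * φ x ε ^ 2 - ω ε) + (s * ε) * (2 * φ x ε ^ 2))
    ((hwc ε).add (continuous_const.mul (hdc ε)))
  obtain ⟨I, hI, hIlim, hTlim⟩ := exists_trace_quotient hwc hdc (by fun_prop) (by fun_prop) hwt hdt
    hτ hb hB h₀
  have hIpos : ∀ᶠ ε in 𝓝 z, 0 < κ * σ * I ε := by
    refine (hIlim.const_mul (κ * σ)).eventually (lt_mem_nhds ?_)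
    simp only [hK]
    rw [show (fun x => 2 * (2 * φ x 0 ^ 2) * (c * φ x 0 ^ 2)) = fun x => 4 * c * φ x 0 ^ 4 by
      ext x; ring, intervalIntegral.integral_const_mul]
    have := intervalIntegral_pow_pos hφ0c (n := 4) (by decide) hy hφy
    have e : κ * σ * (4 * c * ∫ x in (0 : ℝ)..1, φ x 0 ^ 4) =
      4 * ((κ * σ * c) * ∫ x in (0 : ℝ)..1, φ x 0 ^ 4) := by ring
    rw [e]
    positivity
  have hTlow : ∀ᶠ ε in 𝓝 z, -2 < σ * (A ε 1 + B' ε 1) := by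
    refine (hTlim.const_mul σ).eventually (lt_mem_nhds ?_)
    rw [htr₀]
    linarith [show σ * (2 * σ) = 2 by linear_combination 2 * hσ]
  have hφne : ∀ᶠ ε : ι in 𝓝 z, φ x₁ (ε : ℝ) ≠ 0 := by
    have h1 := (h.contDiffOn.continuousOn.continuousAt
      (hD.mem_nhds (show (x₁, (0 : ℝ)) ∈ _ by simp [hδ]))).tendsto
    have h2 : Tendsto (fun ε : ι => (x₁, (ε : ℝ))) (𝓝 z) (𝓝 (x₁, (0 : ℝ))) :=
      tendsto_const_nhds.prodMk_nhds (continuous_subtype_val.tendsto z)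
    exact (h1.comp h2).eventually_ne hx₁
  obtain ⟨r, hr, hball⟩ := Metric.eventually_nhds_iff.1 ((hIpos.and hTlow).and hφne)
  refine ⟨min r δ, lt_min hr hδ, min_le_right _ _, fun ε hε hneg => ?_⟩
  have hεmem : ε ∈ Ioo (-δ) δ := abs_lt.1 (hε.trans_le (min_le_right _ _))
  obtain ⟨⟨hi, hlow⟩, hφx⟩ := hball (y := ⟨ε, hεmem⟩) (by
    rw [Subtype.dist_eq, Real.dist_eq]
    simpa [z] using hε.trans_le (min_le_left _ _))
  have htr := (hb ⟨ε, hεmem⟩).trace_eq (hsol ε hεmem)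
    (hne_of (hb ⟨ε, hεmem⟩) (hsol ε hεmem) hφx) hσ (hper ε hεmem).1 (hper ε hεmem).2
  -- The trace for `L₋` is exactly `2σ` at this `ε`, so the sign of `κ s ε` alone decides on which
  -- side of `2` the quantity `σ` times the trace for `L₊` falls.
  have hup : σ * (A ⟨ε, hεmem⟩ 1 + B' ⟨ε, hεmem⟩ 1) < 2 := by
    have e : σ * (A ⟨ε, hεmem⟩ 1 + B' ⟨ε, hεmem⟩ 1) - 2 =
        (κ * (s * ε)) * (κ * σ * I ⟨ε, hεmem⟩) := by
      linear_combination σ * hI ⟨ε, hεmem⟩ + σ * htr + 2 * hσ -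
        (s * ε * σ * I ⟨ε, hεmem⟩) * hκ
    linarith [mul_neg_of_neg_of_pos hneg hi]
  have hB' : IsHillBasis (fun x => V x + 3 * (s * ε) * φ x ε ^ 2 - ω ε) (A ⟨ε, hεmem⟩)
      (A' ⟨ε, hεmem⟩) (B ⟨ε, hεmem⟩) (B' ⟨ε, hεmem⟩) := by
    convert! hB ⟨ε, hεmem⟩ using 2
    ring
  refine exists_imaginary_interval hV (hφc ε hεmem) hB' (hb ⟨ε, hεmem⟩) ?_ hσ htr
  rw [abs_lt]
  rcases sq_eq_sq_iff_eq_or_eq_neg.1 (hσ.trans (one_pow 2).symm) with rfl | rfl <;>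
    constructor <;> linarith

end Family

end PeriodicNLS

theorem theorem2
    (V : ℝ → ℝ) (hVc : Continuous V) (hVp : Function.Periodic V 1)
    (s : ℝ) (hs : s = 1 ∨ s = -1)
    (δ : ℝ) (hδ : 0 < δ)
    (φ : ℝ → ℝ → ℝ) (ω : ℝ → ℝ)
    (hφ : PeriodicNLS.IsStandingWaveFamily V s δ φ ω)
    (hdouble : ¬ PeriodicNLS.IsDoublePoint V (ω 0)) :
    (PeriodicNLS.IsLowerBandEdge V (ω 0) →
      ∃ ε₀ > 0, ε₀ ≤ δ ∧ ∀ ε : ℝ, |ε| < ε₀ → s * ε < 0 →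
        ∃ η > 0, ∀ t : ℝ, |t| < η →
          (t : ℂ) * Complex.I ∈
            PeriodicNLS.stabilitySpectrum V (s * ε) (ω ε) (fun x => φ x ε)) ∧
    (PeriodicNLS.IsUpperBandEdge V (ω 0) →
      ∃ ε₀ > 0, ε₀ ≤ δ ∧ ∀ ε : ℝ, |ε| < ε₀ → 0 < s * ε →
        ∃ η > 0, ∀ t : ℝ, |t| < η →
          (t : ℂ) * Complex.I ∈
            PeriodicNLS.stabilitySpectrum V (s * ε) (ω ε) (fun x => φ x ε)) := by
  constructor
  · rintro ⟨-, η, hη, hband⟩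
    obtain ⟨ε₀, h0, hle, h⟩ := hφ.exists_imaginary_spectrum hVc hδ hdouble (κ := 1) (by norm_num) hη
      fun t ht => hband ⟨by linarith [ht.1], by linarith [ht.2]⟩
    exact ⟨ε₀, h0, hle, fun ε hε hs => h ε hε (by linarith)⟩
  · rintro ⟨-, η, hη, hband⟩
    obtain ⟨ε₀, h0, hle, h⟩ := hφ.exists_imaginary_spectrum hVc hδ hdouble (κ := -1) (by norm_num)
      hη fun t ht => hband ⟨by linarith [ht.2], by linarith [ht.1]⟩
    exact ⟨ε₀, h0, hle, fun ε hε hs => h ε hε (by linarith)⟩
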